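/- Let $\Bbbk$ be a field of positive characteristic $p$, let $m\ge 0$, and let $d_1,\dots,d_m$ be positive integers. Let $\mathbb{K}=\Bbbk(a_{i,\mathbf r})$ be the field of rational functions over $\Bbbk$ in independent variables $a_{i,\mathbf r}$, one for each $i\in\{1,\dots,m\}$ and each $\mathbf r\in\mathbb{N}^m$ with $|\mathbf r|=r_1+\cdots+r_m=d_i$. Put $$g_i=\sum_{|\mathbf r|=d_i}a_{i,\mathbf r}\,x_1^{r_1}\cdots x_m^{r_m}\in\mathbb{K}[x_1,\dots,x_m]\quad(1\le i\le m),\qquad \mathcal A=\mathbb{K}[x_1,\dots,x_m]/(g_1,\dots,g_m),$$ where $\mathcal A=\bigoplus_{i\ge0}\mathcal A_i$ carries the standard grading. Let $\ell\in\mathcal A_1$ be the class of $x_1+\cdots+x_m$, and let $s=d_1+\cdots+d_m-m$. 1. For every integer $i$ with $0\le i\le s/p$, the multiplication map $\times\ell^{\,s-pi}:\mathcal A_i\to\mathcal A_{i+s-pi}$ is injective. 2. If $p=2$, then $\mathcal A$ has the Strong Lefschetz Property: there is $L\in\mathcal A_1$ such that for all integers $i,k\ge0$ the multiplication map $\times L^k:\mathcal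 A_i\to\mathcal A_{i+k}$ is injective or surjective. Moreover, for every integer $i$ with $0\le i\le s/2$, the map $\times\ell^{\,s-2i}:\mathcal A_i\to\mathcal A_{s-i}$ is bijective. -/

import Mathlib

noncomputable section

namespace GenericCI

section Lefschetz

variable {K A : Type*} [Field K] [CommRing A] [Algebra K A]

/-- For a commutative `K`-algebra `A` with graded pieces `𝒜 i` and an element `L` of degree one,
multiplication by `L ^ k` as a `K`-linear map `𝒜 i → 𝒜 (i + k)`. -/
def mulPow (𝒜 : ℕ → Submodule K A) [SetLike.GradedMonoid 𝒜] (L : 𝒜 1) (i k : ℕ) :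
    𝒜 i →ₗ[K] 𝒜 (i + k) :=
  (LinearMap.mulLeft K ((L : A) ^ k)).restrict (by
    intro a ha
    have h := SetLike.mul_mem_graded (SetLike.pow_mem_graded k L.2) ha
    simpa [add_comm] using h)

/-- The Strong Lefschetz Property: there is an element `L` of degree one all of whose powers have
full rank, that is, every multiplication map `L ^ k : 𝒜 i → 𝒜 (i + k)` is injective or
surjective. -/
def HasStrongLefschetzProperty (𝒜 : ℕ → Submodule K A) [SetLike.GradedMonoid 𝒜] : Prop :=
  ∃ L : 𝒜 1, ∀ i k : ℕ,
    Function.Injective (mulPow 𝒜 L i k) ∨ Function.Surjective (mulPow 𝒜 L i k)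

end Lefschetz

section GradedQuotient

variable {K : Type*} [Field K] {m : ℕ}

/-- The degree `i` piece of `K[x₁, …, x_m] / I`: the image of the homogeneous polynomials of
degree `i`. -/
def quotientPiece (I : Ideal (MvPolynomial (Fin m) K)) (i : ℕ) :
    Submodule K (MvPolynomial (Fin m) K ⧸ I) :=
  (MvPolynomial.homogeneousSubmodule (Fin m) K i).map (Ideal.Quotient.mkₐ K I).toLinearMap

instance quotientPiece_gradedMonoid (I : Ideal (MvPolynomial (Fin m) K)) :
    SetLike.GradedMonoid (quotientPiece I) where
  one_mem := ⟨1, MvPolynomial.isHomogeneous_one _ _, map_one (Ideal.Quotient.mkₐ K I)⟩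
  mul_mem := by
    rintro i j _ _ ⟨a, ha, rfl⟩ ⟨b, hb, rfl⟩
    exact ⟨a * b, MvPolynomial.IsHomogeneous.mul ha hb, map_mul (Ideal.Quotient.mkₐ K I) a b⟩

/-- The class of `x₁ + ⋯ + x_m` in `K[x₁, …, x_m] / I`, as an element of degree one. -/
def sumVars (I : Ideal (MvPolynomial (Fin m) K)) : quotientPiece I 1 :=
  ⟨Ideal.Quotient.mkₐ K I (∑ t : Fin m, MvPolynomial.X t),
    ⟨∑ t : Fin m, MvPolynomial.X t,
      MvPolynomial.IsHomogeneous.sum _ _ _ (fun t _ => MvPolynomial.isHomogeneous_X K t), rfl⟩⟩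

end GradedQuotient

section Generic

variable (k : Type*) [Field k] {m : ℕ} (d : Fin m → ℕ)

/-- The pairs `(i, r)` with `r ∈ ℕ^m` and `|r| = d i`. -/
abbrev Index : Type :=
  Σ i : Fin m, {r : Fin m →₀ ℕ // r ∈ Finset.finsuppAntidiag Finset.univ (d i)}

/-- The field of rational functions over `k` in the variables `a_{i, r}`. -/
abbrev CoeffField : Type _ := FractionRing (MvPolynomial (Index d) k)

/-- The variable `a_{i, r}` as an element of the field of rational functions. -/
def coeffVar (j : Index d) : CoeffField k d :=
  algebraMap (MvPolynomial (Index d) k) (CoeffField k d) (MvPolynomial.X j)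

/-- The generic form of degree `d i`: the sum of `a_{i, r} x ^ r` over all `r` with `|r| = d i`. -/
def genericForm (i : Fin m) : MvPolynomial (Fin m) (CoeffField k d) :=
  ∑ r : {r : Fin m →₀ ℕ // r ∈ Finset.finsuppAntidiag Finset.univ (d i)},
    MvPolynomial.monomial r.1 (coeffVar k d ⟨i, r⟩)

/-- The ideal generated by the generic forms. The generic complete intersection reduction is the
quotient of `MvPolynomial (Fin m) (CoeffField k d)` by this ideal. -/
def genericIdeal : Ideal (MvPolynomial (Fin m) (CoeffField k d)) :=
  Ideal.span (Set.range (genericForm k d))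

/-- The number `d₁ + ⋯ + d_m - m`; the subtraction does not truncate when all `d i` are
positive. -/
def topDegree : ℕ := (∑ i, d i) - m

end Generic

end GenericCI

end

/-!
Macaulay duality for the complete intersection `𝒜` is realized by an explicit residue, on which the
coefficients of the forms can be differentiated; it is here that the characteristic `p` enters.

The coefficients `a_{i,r}` are expanded around the forms `x_i ^ d_i`, that is,
`a_{i,r} = b_{i,r} + [x ^ r = x_i ^ d_i]`. Then each `g_i` is a power series in the `b_{i,r}` over
the Laurent polynomials in `x`, with the invertible constant coefficient `x_i ^ d_i`. The residue of
`F` is the coefficient of `(x_1 ⋯ x_m)⁻¹` in `F / (g_1 ⋯ g_m)`, a power series in the `b_{i,r}` over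
`k`.

* The residue vanishes on the ideal `(g_1, …, g_m)`: once `g_j` is cancelled, no negative power of
  `x_j` is left (`residue_mul_integralForm`).
* The monomials `x ^ u` of degree `n` with `u i < d i` for all `i` form a basis of `𝒜_n`, and the
  residue pairing `𝒜_n × 𝒜_{s-n}` is nondegenerate. Both hold because the relevant matrices
  specialize to the identity at `b = 0` (`exists_smul_mem`, `eq_zero_of_residue_sum_box`).
* Differentiating `1 / (g_1 ⋯ g_m)` by `p - 1` coefficients of each form gives a nonzero multiple of
  `x ^ N / (g_1 ⋯ g_m) ^ p`, where `x ^ N` can be any monomial of degree `(p - 1) (d_1 + ⋯ + d_m)`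
  (`exists_diffOp`), and the coefficients of a `p`-th power are `p`-th powers of coefficients.

Let `ℓ = x_1 + ⋯ + x_m`, and suppose that `ℓ ^ q * H ^ p` vanishes in `𝒜`, where `q < p` and the
degree is at most `s`. Then its products with monomials of the complementary degree have residue
zero. Differential operators as above treat `H ^ p` as a constant, and a suitable choice of `N`
isolates the monomial `x_j ^ q` of `ℓ ^ q`, so they turn this residue into the `p`-th power of the
residue of `x ^ w * H` (`residue_monomial_mul_eq_zero`). Since `w` is arbitrary of degree
`s - deg H`, nondegeneracy gives `H = 0` in `𝒜` (`mem_genericIdeal_of_pow_char`).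

Finally, suppose `ℓ ^ n * G = 0` with `deg G = i` and `p * i + n ≤ s`, and write `n = p * n' + q`
with `q < p`. Then `ℓ ^ n * G ^ p = ℓ ^ q * (ℓ ^ n' * G) ^ p` vanishes, hence `ℓ ^ n' * G = 0`, and
induction on `n` gives `G = 0` (`mem_genericIdeal_of_sum_pow_mul`). For `p = 2` the injection
`𝒜_i → 𝒜_{s-i}` is bijective because `u ↦ d - 1 - u` matches the two monomial bases, and the Strong
Lefschetz Property follows by factoring these bijections.
-/

noncomputable section

namespace GenericCI

/-! ### Power series with Laurent polynomial coefficients -/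

section LaurentCoefficients

variable {k : Type*} [Field k] {σ : Type*} {m : ℕ}

/-- Laurent polynomials in `m` variables over `k`. -/
abbrev Laurent (k : Type*) [Field k] (m : ℕ) : Type _ := AddMonoidAlgebra k (Fin m → ℤ)

/-- The Laurent monomial `x ^ v`, as a constant power series over the Laurent polynomials. -/
def xpow (v : Fin m → ℤ) : MvPowerSeries σ (Laurent k m) :=
  MvPowerSeries.C (AddMonoidAlgebra.single v 1)

/-- A power series over `k`, regarded as a power series over the Laurent polynomials. -/
def incl : MvPowerSeries σ k →+* MvPowerSeries σ (Laurent k m) :=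
  MvPowerSeries.map (algebraMap k (Laurent k m))

/-- The coefficient of `x ^ v` in a power series over the Laurent polynomials: it is a power series
over `k`. -/
def xcoeff (v : Fin m → ℤ) : MvPowerSeries σ (Laurent k m) →+ MvPowerSeries σ k where
  toFun f := fun n => (MvPowerSeries.coeff n f).coeff v
  map_zero' := rfl
  map_add' _ _ := rfl

@[simp]
lemma coeff_xcoeff (v : Fin m → ℤ) (f : MvPowerSeries σ (Laurent k m)) (n : σ →₀ ℕ) :
    MvPowerSeries.coeff n (xcoeff v f) = (MvPowerSeries.coeff n f).coeff v := rfl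

lemma xpow_zero : (xpow 0 : MvPowerSeries σ (Laurent k m)) = 1 := by
  simp [xpow, ← AddMonoidAlgebra.one_def]

lemma xpow_add (u v : Fin m → ℤ) :
    (xpow (u + v) : MvPowerSeries σ (Laurent k m)) = xpow u * xpow v := by
  simp [xpow, ← map_mul, AddMonoidAlgebra.single_mul_single]

lemma xpow_sum {α : Type*} (s : Finset α) (f : α → Fin m → ℤ) :
    (xpow (∑ a ∈ s, f a) : MvPowerSeries σ (Laurent k m)) = ∏ a ∈ s, xpow (f a) := by
  classical
  induction s using Finset.induction_on with
  | empty => simp [xpow_zero]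
  | insert a s ha ih => rw [Finset.sum_insert ha, Finset.prod_insert ha, xpow_add, ih]

lemma xpow_nsmul (n : ℕ) (v : Fin m → ℤ) :
    (xpow (n • v) : MvPowerSeries σ (Laurent k m)) = xpow v ^ n := by
  induction n with
  | zero => simp [xpow_zero]
  | succ n ih => rw [succ_nsmul, xpow_add, ih, pow_succ]

lemma xcoeff_xpow_mul (u v : Fin m → ℤ) (f : MvPowerSeries σ (Laurent k m)) :
    xcoeff v (xpow u * f) = xcoeff (v - u) f := by
  ext n
  simp [xpow, MvPowerSeries.coeff_C_mul, neg_add_eq_sub]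

lemma xcoeff_incl_mul (v : Fin m → ℤ) (r : MvPowerSeries σ k)
    (f : MvPowerSeries σ (Laurent k m)) : xcoeff v (incl r * f) = r * xcoeff v f := by
  classical
  ext n
  simp only [coeff_xcoeff, MvPowerSeries.coeff_mul, incl, MvPowerSeries.coeff_map,
    ← Algebra.smul_def, AddMonoidAlgebra.coeff_sum, Finsupp.finsetSum_apply,
    AddMonoidAlgebra.coeff_smul, Finsupp.smul_apply, smul_eq_mul]

lemma xcoeff_pderiv (v : Fin m → ℤ) (j : σ) (f : MvPowerSeries σ (Laurent k m)) :
    xcoeff v (MvPowerSeries.pderiv (Laurent k m) j f) =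
      MvPowerSeries.pderiv k j (xcoeff v f) := by
  ext n
  simp only [coeff_xcoeff, MvPowerSeries.coeff_pderiv]
  have : ((n j : Laurent k m) + 1) = algebraMap k (Laurent k m) ((n j : k) + 1) := by
    rw [map_add, map_natCast, map_one]
  rw [this, mul_comm, ← Algebra.smul_def, AddMonoidAlgebra.coeff_smul, Finsupp.smul_apply,
    smul_eq_mul, mul_comm]

lemma pderiv_xpow (v : Fin m → ℤ) (j : σ) :
    MvPowerSeries.pderiv (Laurent k m) j (xpow v : MvPowerSeries σ (Laurent k m)) = 0 :=
  MvPowerSeries.pderiv_C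

lemma pderiv_incl_X (i j : σ) [Decidable (i = j)] :
    MvPowerSeries.pderiv (Laurent k m) j (incl (MvPowerSeries.X i)) = if i = j then 1 else 0 := by
  rw [incl, MvPowerSeries.map_X]
  split_ifs with h
  · subst h; exact MvPowerSeries.pderiv_X_self
  · exact MvPowerSeries.pderiv_X_of_ne h

/-- The Laurent polynomials in which `x_j` occurs only with nonnegative exponents. -/
def nonnegLaurent (k : Type*) [Field k] {m : ℕ} (j : Fin m) : Subalgebra k (Laurent k m) where
  carrier := {f | ∀ v : Fin m → ℤ, v j < 0 → f.coeff v = 0}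
  mul_mem' := by
    intro f g hf hg v hv
    classical
    rw [AddMonoidAlgebra.coeff_mul]
    refine Finset.sum_eq_zero fun a _ => Finset.sum_eq_zero fun b _ => ?_
    dsimp only
    split_ifs with h
    · subst h
      rcases lt_or_ge (a j) 0 with ha | ha
      · rw [hf a ha, zero_mul]
      · rw [hg b (by simp only [Pi.add_apply] at hv; lia), mul_zero]
    · rfl
  add_mem' := by
    intro f g hf hg v hv
    simp [hf v hv, hg v hv]
  algebraMap_mem' := by
    intro r v hv
    have : v ≠ 0 := by rintro rfl; simp at hv
    simp [this]

lemma single_mem_nonnegLaurent {j : Fin m} {v : Fin m → ℤ} (hv : 0 ≤ v j) (c : k) :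
    AddMonoidAlgebra.single v c ∈ nonnegLaurent k j := by
  intro u hu
  have : v ≠ u := by rintro rfl; lia
  simp [this]

/-- The power series whose coefficients are Laurent polynomials in which `x_j` occurs only with
nonnegative exponents, encoded as the range of a map of power series rings: an inverse can then be
computed in the source of that map. -/
def nonnegSeries (k : Type*) [Field k] (σ : Type*) {m : ℕ} (j : Fin m) :
    Subring (MvPowerSeries σ (Laurent k m)) :=
  (MvPowerSeries.map (nonnegLaurent k j).val.toRingHom).range

lemma xcoeff_eq_zero_of_mem_nonnegSeries {j : Fin m} {f : MvPowerSeries σ (Laurent k m)}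
    (hf : f ∈ nonnegSeries k σ j) {v : Fin m → ℤ} (hv : v j < 0) : xcoeff v f = 0 := by
  obtain ⟨g, rfl⟩ := hf
  ext n
  rw [coeff_xcoeff, MvPowerSeries.coeff_map]
  exact (MvPowerSeries.coeff n g).2 v hv

lemma xpow_mem_nonnegSeries {j : Fin m} {v : Fin m → ℤ} (hv : 0 ≤ v j) :
    xpow v ∈ nonnegSeries k σ j :=
  ⟨MvPowerSeries.C ⟨_, single_mem_nonnegLaurent hv 1⟩, by rw [MvPowerSeries.map_C]; rfl⟩

lemma incl_mem_nonnegSeries (j : Fin m) (r : MvPowerSeries σ k) :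
    incl r ∈ nonnegSeries k σ j := by
  refine ⟨MvPowerSeries.map (algebraMap k (nonnegLaurent k j)) r, ?_⟩
  ext1 n
  simp only [MvPowerSeries.coeff_map, incl]
  rfl

lemma mem_nonnegSeries_of_mul_eq_one {j : Fin m} {f g : MvPowerSeries σ (Laurent k m)}
    (hf : f ∈ nonnegSeries k σ j) {v : Fin m → ℤ}
    (h0 : MvPowerSeries.constantCoeff f = AddMonoidAlgebra.single v 1) (hv : v j = 0)
    (hfg : f * g = 1) : g ∈ nonnegSeries k σ j := by
  obtain ⟨f', rfl⟩ := hf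
  have hu : IsUnit f' := by
    rw [MvPowerSeries.isUnit_iff_constantCoeff]
    refine IsUnit.of_mul_eq_one ⟨_, single_mem_nonnegLaurent (v := -v) (by simp [hv]) 1⟩ ?_
    apply Subtype.ext
    rw [MvPowerSeries.constantCoeff_map] at h0
    change (nonnegLaurent k j).val.toRingHom (MvPowerSeries.constantCoeff f') *
      AddMonoidAlgebra.single (-v) 1 = 1
    rw [h0, AddMonoidAlgebra.single_mul_single]
    simp [AddMonoidAlgebra.one_def]
  obtain ⟨g', hg'⟩ := hu.exists_right_inv
  refine ⟨g', ?_⟩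
  have h1 : MvPowerSeries.map (nonnegLaurent k j).val.toRingHom f' *
      MvPowerSeries.map (nonnegLaurent k j).val.toRingHom g' = 1 := by
    rw [← map_mul, hg', map_one]
  exact (left_inv_eq_right_inv ((mul_comm _ _).trans hfg) h1).symm

section Frobenius

variable (p : ℕ) [Fact p.Prime] [CharP k p]

lemma Laurent.coeff_pow_char (f : Laurent k m) (v : Fin m → ℤ) :
    (f ^ p).coeff (p • v) = f.coeff v ^ p := by
  have : CharP (Laurent k m) p := charP_of_injective_algebraMap
    (algebraMap k (Laurent k m)).injective p
  induction f using AddMonoidAlgebra.induction_linear with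
  | zero => simp [(Fact.out : p.Prime).ne_zero]
  | add f g hf hg => rw [add_pow_char, AddMonoidAlgebra.coeff_add, Finsupp.add_apply, hf, hg,
      AddMonoidAlgebra.coeff_add, Finsupp.add_apply, add_pow_char]
  | single u c =>
    classical
    have h : p • u = p • v ↔ u = v := by
      constructor
      · intro h
        ext i
        have := congrFun h i
        simpa [(Fact.out : p.Prime).ne_zero] using this
      · rintro rfl; rfl
    simp only [AddMonoidAlgebra.single_pow, AddMonoidAlgebra.coeff_single, Finsupp.single_apply, h]
    split_ifs <;> simp [(Fact.out : p.Prime).ne_zero]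

lemma Laurent.coeff_pow_char_of_not_dvd (f : Laurent k m) {v : Fin m → ℤ} {i : Fin m}
    (hv : ¬ (p : ℤ) ∣ v i) : (f ^ p).coeff v = 0 := by
  have : CharP (Laurent k m) p := charP_of_injective_algebraMap
    (algebraMap k (Laurent k m)).injective p
  induction f using AddMonoidAlgebra.induction_linear with
  | zero => simp [(Fact.out : p.Prime).ne_zero]
  | add f g hf hg => rw [add_pow_char]; simp [hf, hg]
  | single u c =>
    have h : p • u ≠ v := by
      rintro rfl
      exact hv ⟨u i, by simp⟩
    rw [AddMonoidAlgebra.single_pow, AddMonoidAlgebra.coeff_single, Finsupp.single_apply, if_neg h]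

lemma coeff_pow_char {B : Type*} [CommRing B] [ExpChar B p] (f : MvPowerSeries σ B)
    (n : σ →₀ ℕ) : MvPowerSeries.coeff (p • n) (f ^ p) = MvPowerSeries.coeff n f ^ p := by
  rw [← MvPowerSeries.map_frobenius_expand p (Fact.out : p.Prime).ne_zero,
    MvPowerSeries.coeff_map, MvPowerSeries.coeff_expand_smul, frobenius_def]

lemma coeff_pow_char_of_not_dvd {B : Type*} [CommRing B] [ExpChar B p] (f : MvPowerSeries σ B)
    {n : σ →₀ ℕ} {i : σ} (hn : ¬ p ∣ n i) : MvPowerSeries.coeff n (f ^ p) = 0 := by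
  rw [← MvPowerSeries.map_frobenius_expand p (Fact.out : p.Prime).ne_zero,
    MvPowerSeries.coeff_map, MvPowerSeries.coeff_expand_of_not_dvd _ _ _ hn, map_zero]

lemma xcoeff_pow_char (f : MvPowerSeries σ (Laurent k m)) (v : Fin m → ℤ) :
    xcoeff (p • v) (f ^ p) = xcoeff v f ^ p := by
  have : CharP (Laurent k m) p := charP_of_injective_algebraMap
    (algebraMap k (Laurent k m)).injective p
  have : ExpChar (Laurent k m) p := ExpChar.prime Fact.out
  have : ExpChar k p := ExpChar.prime Fact.out
  ext n
  rw [coeff_xcoeff]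
  by_cases h : ∀ i, p ∣ n i
  · obtain ⟨n, rfl⟩ : ∃ n', n = p • n' := ⟨n.mapRange (fun a => a / p) (by simp), by
      ext i; simp [Nat.mul_div_cancel' (h i)]⟩
    rw [coeff_pow_char, coeff_pow_char, Laurent.coeff_pow_char, coeff_xcoeff]
  · push Not at h
    obtain ⟨i, hi⟩ := h
    rw [coeff_pow_char_of_not_dvd p _ hi, coeff_pow_char_of_not_dvd p _ hi]
    rfl

lemma xcoeff_pow_char_of_not_dvd (f : MvPowerSeries σ (Laurent k m)) {v : Fin m → ℤ} {i : Fin m}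
    (hv : ¬ (p : ℤ) ∣ v i) : xcoeff v (f ^ p) = 0 := by
  have : CharP (Laurent k m) p := charP_of_injective_algebraMap
    (algebraMap k (Laurent k m)).injective p
  have : ExpChar (Laurent k m) p := ExpChar.prime Fact.out
  ext n
  rw [coeff_xcoeff]
  by_cases h : ∀ i, p ∣ n i
  · obtain ⟨n, rfl⟩ : ∃ n', n = p • n' := ⟨n.mapRange (fun a => a / p) (by simp), by
      ext i; simp [Nat.mul_div_cancel' (h i)]⟩
    rw [coeff_pow_char, Laurent.coeff_pow_char_of_not_dvd p _ hv]
    rfl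
  · push Not at h
    obtain ⟨i, hi⟩ := h
    rw [coeff_pow_char_of_not_dvd p _ hi]
    rfl

/-- Among the monomials of `(x₁ + ⋯ + x_m) ^ q` with `q < p`, only `x_j ^ q` has an exponent
congruent to `q e_j` modulo `p`, so it alone contributes to this coefficient. -/
lemma xcoeff_sum_pow_mul_pow_char (f : MvPowerSeries σ (Laurent k m)) (v : Fin m → ℤ)
    (j : Fin m) {q : ℕ} (hq : q < p) :
    xcoeff (p • v + Pi.single j (q : ℤ)) ((∑ i, xpow (Pi.single i 1)) ^ q * f ^ p) =
      xcoeff v f ^ p := by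
  classical
  have hprod : ∀ e : Fin m → ℕ, ∏ i, (xpow (Pi.single i 1) : MvPowerSeries σ (Laurent k m)) ^ e i =
      xpow (fun i => (e i : ℤ)) := by
    intro e
    simp_rw [← xpow_nsmul, ← xpow_sum]
    congr 1
    ext i
    simp [Finset.sum_apply, Pi.single_apply]
  rw [Finset.sum_pow_eq_sum_piAntidiag, Finset.sum_mul, map_sum,
    Finset.sum_eq_single (Pi.single j q)]
  · have h1 : Nat.multinomial Finset.univ (Pi.single j q : Fin m → ℕ) = 1 :=
      Nat.multinomial_single _ _ _
    have h2 : (fun i => ((Pi.single j q : Fin m → ℕ) i : ℤ)) = Pi.single j (q : ℤ) := by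
      ext i
      by_cases hij : i = j <;> simp [hij]
    rw [hprod, h1, h2, Nat.cast_one, one_mul, xcoeff_xpow_mul, add_sub_cancel_right,
      xcoeff_pow_char]
  · intro e he hne
    rw [hprod, mul_assoc, ← nsmul_eq_mul, map_nsmul, xcoeff_xpow_mul,
      xcoeff_pow_char_of_not_dvd p (i := j), smul_zero]
    rw [Finset.mem_piAntidiag] at he
    intro hdvd
    apply hne
    have hle : e j ≤ q := he.1 ▸ Finset.single_le_sum (fun _ _ => Nat.zero_le _) (Finset.mem_univ j)
    have hej : e j = q := by
      have h3 : (p : ℤ) ∣ ((q - e j : ℕ) : ℤ) := by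
        have h4 : ((q - e j : ℕ) : ℤ) =
            (p • v + Pi.single j (q : ℤ) - (fun i => (e i : ℤ)) : Fin m → ℤ) j - p * v j := by
          simp [Nat.cast_sub hle]
          ring
        rw [h4]
        exact dvd_sub hdvd (dvd_mul_right _ _)
      have h5 := Nat.eq_zero_of_dvd_of_lt (Int.natCast_dvd_natCast.mp h3) (by lia)
      lia
    have hsum : ∑ i ∈ Finset.univ.erase j, e i = 0 := by
      have := Finset.add_sum_erase Finset.univ e (Finset.mem_univ j)
      have := he.1
      lia
    ext i
    by_cases hij : i = j
    · subst hij; simp [hej]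
    · rw [Pi.single_eq_of_ne hij]
      exact (Finset.sum_eq_zero_iff.mp hsum) i (by simp [hij])
  · intro h
    exact absurd (by simp [Finset.mem_piAntidiag]) h

end Frobenius

end LaurentCoefficients

/-! ### Expansions of the generic forms and the residue -/

section GenericForms

variable (k : Type*) [Field k] {m : ℕ} (d : Fin m → ℕ)

/-- The ring `k[a]` of polynomials in the coefficients of the generic forms. -/
abbrev CoeffRing : Type _ := MvPolynomial (Index d) k

/-- The generic form of degree `d i` with coefficients in `k[a]` instead of `k(a)`. -/
def integralForm (i : Fin m) : MvPolynomial (Fin m) (CoeffRing k d) :=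
  ∑ r : {r : Fin m →₀ ℕ // r ∈ Finset.finsuppAntidiag Finset.univ (d i)},
    MvPolynomial.monomial r.1 (MvPolynomial.X ⟨i, r⟩)

/-- The ideal of `k[a][x]` generated by the generic forms. -/
def integralIdeal : Ideal (MvPolynomial (Fin m) (CoeffRing k d)) :=
  Ideal.span (Set.range (integralForm k d))

open Classical in
/-- The indicator of the coefficient of `x_i ^ d_i` in the generic form of degree `d i`: these are
the coefficients of the regular sequence `x_1 ^ d_1, …, x_m ^ d_m`. -/
def basePoint (j : Index d) : k := if j.2.1 = Finsupp.single j.1 (d j.1) then 1 else 0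

/-- Taylor expansion of a polynomial in the coefficients at the base point, that is, at the forms
`x_i ^ d_i`. -/
def taylor : CoeffRing k d →ₐ[k] MvPowerSeries (Index d) k :=
  MvPolynomial.aeval fun j => MvPowerSeries.X j + MvPowerSeries.C (basePoint k d j)

lemma taylor_X (j : Index d) :
    taylor k d (MvPolynomial.X j) = MvPowerSeries.X j + MvPowerSeries.C (basePoint k d j) :=
  MvPolynomial.aeval_X _ _

lemma taylor_injective : Function.Injective (taylor k d) := by
  let τ : CoeffRing k d →ₐ[k] CoeffRing k d :=
    MvPolynomial.aeval fun j => MvPolynomial.X j + MvPolynomial.C (basePoint k d j)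
  let τ' : CoeffRing k d →ₐ[k] CoeffRing k d :=
    MvPolynomial.aeval fun j => MvPolynomial.X j - MvPolynomial.C (basePoint k d j)
  have h1 : taylor k d = (MvPolynomial.coeToMvPowerSeries.algHom k).comp τ := by
    apply MvPolynomial.algHom_ext
    intro j
    simp [taylor, τ]
  have h2 : τ'.comp τ = AlgHom.id k _ := by
    apply MvPolynomial.algHom_ext
    intro j
    simp [τ, τ', MvPolynomial.algebraMap_eq]
  have hτ : Function.Injective τ := by
    intro x y hxy
    have h := congrArg τ' hxy
    rwa [← AlgHom.comp_apply, ← AlgHom.comp_apply, h2] at h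
  rw [h1]
  intro x y hxy
  apply hτ
  simpa using hxy

/-- Expansion of a polynomial in `x` over `k[a]` as a power series over the Laurent polynomials
in `x`. -/
def expansion : MvPolynomial (Fin m) (CoeffRing k d) →+* MvPowerSeries (Index d) (Laurent k m) :=
  MvPolynomial.eval₂Hom (incl.comp (taylor k d).toRingHom) fun i => xpow (Pi.single i 1)

lemma expansion_C (c : CoeffRing k d) :
    expansion k d (MvPolynomial.C c) = incl (taylor k d c) :=
  MvPolynomial.eval₂Hom_C _ _ _

lemma expansion_X (i : Fin m) :
    expansion k d (MvPolynomial.X i) = xpow (Pi.single i 1) :=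
  MvPolynomial.eval₂Hom_X' _ _ _

/-- An exponent vector of natural numbers as a vector of integers. -/
def toInt (u : Fin m →₀ ℕ) : Fin m → ℤ := fun i => (u i : ℤ)

@[simp] lemma toInt_apply (u : Fin m →₀ ℕ) (i : Fin m) : toInt u i = (u i : ℤ) := rfl

lemma toInt_add (u v : Fin m →₀ ℕ) : toInt (u + v) = toInt u + toInt v := by
  ext i; simp

lemma expansion_monomial (u : Fin m →₀ ℕ) (c : CoeffRing k d) :
    expansion k d (MvPolynomial.monomial u c) = incl (taylor k d c) * xpow (toInt u) := by
  rw [MvPolynomial.monomial_eq, map_mul, expansion_C,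
    Finsupp.prod_fintype _ _ (fun i => pow_zero _), map_prod]
  congr 1
  simp_rw [map_pow, expansion_X, ← xpow_nsmul, ← xpow_sum]
  congr 1
  ext i
  simp [Finset.sum_apply, Pi.single_apply]

lemma expansion_integralForm (i : Fin m) :
    expansion k d (integralForm k d i) =
      ∑ r : {r : Fin m →₀ ℕ // r ∈ Finset.finsuppAntidiag Finset.univ (d i)},
        incl (MvPowerSeries.X ⟨i, r⟩ + MvPowerSeries.C (basePoint k d ⟨i, r⟩)) *
          xpow (toInt r.1) := by
  simp_rw [integralForm, map_sum, expansion_monomial, taylor_X]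

lemma single_mem_finsuppAntidiag (i : Fin m) (n : ℕ) :
    Finsupp.single i n ∈ Finset.finsuppAntidiag Finset.univ n := by
  simp [Finset.mem_finsuppAntidiag, Finsupp.single_apply]

lemma constantCoeff_expansion_integralForm (i : Fin m) :
    MvPowerSeries.constantCoeff (expansion k d (integralForm k d i)) =
      AddMonoidAlgebra.single (Pi.single i (d i : ℤ)) 1 := by
  rw [expansion_integralForm, map_sum,
    Finset.sum_eq_single ⟨Finsupp.single i (d i), single_mem_finsuppAntidiag i (d i)⟩]
  · have : toInt (Finsupp.single i (d i)) = Pi.single i (d i : ℤ) := by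
      ext j
      by_cases hij : j = i
      · subst hij; simp
      · simp [hij]
    simp [basePoint, xpow, incl, this]
  · intro r _ hr
    have : r.1 ≠ Finsupp.single i (d i) := fun h => hr (Subtype.ext h)
    simp [basePoint, incl, this]
  · simp

/-- The expansion of the generic form of degree `d i`, as a unit: its constant coefficient is
the Laurent monomial `x_i ^ d_i`. -/
def formUnit (i : Fin m) : (MvPowerSeries (Index d) (Laurent k m))ˣ :=
  IsUnit.unit (a := expansion k d (integralForm k d i)) <| by
    rw [MvPowerSeries.isUnit_iff_constantCoeff, constantCoeff_expansion_integralForm]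
    refine IsUnit.of_mul_eq_one (AddMonoidAlgebra.single (-Pi.single i (d i : ℤ)) 1) ?_
    rw [AddMonoidAlgebra.single_mul_single]
    simp [AddMonoidAlgebra.one_def]

@[simp] lemma val_formUnit (i : Fin m) :
    (formUnit k d i : MvPowerSeries (Index d) (Laurent k m)) =
      expansion k d (integralForm k d i) := IsUnit.unit_spec _

/-- The expansion of `∏ g_i ^ (-e i)`. -/
def invForms (e : Fin m → ℕ) : MvPowerSeries (Index d) (Laurent k m) :=
  ∏ i, ((formUnit k d i)⁻¹ : (MvPowerSeries (Index d) (Laurent k m))ˣ) ^ e i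

lemma constantCoeff_inv_formUnit (i : Fin m) :
    MvPowerSeries.constantCoeff
      (((formUnit k d i)⁻¹ : (MvPowerSeries (Index d) (Laurent k m))ˣ) :
        MvPowerSeries (Index d) (Laurent k m)) =
      AddMonoidAlgebra.single (-Pi.single i (d i : ℤ)) 1 := by
  have h1 : MvPowerSeries.constantCoeff (formUnit k d i : MvPowerSeries (Index d) (Laurent k m)) *
      MvPowerSeries.constantCoeff (((formUnit k d i)⁻¹ :
        (MvPowerSeries (Index d) (Laurent k m))ˣ) : MvPowerSeries (Index d) (Laurent k m)) = 1 := by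
    rw [← map_mul, Units.mul_inv, map_one]
  refine (left_inv_eq_right_inv ?_ h1).symm
  rw [val_formUnit, constantCoeff_expansion_integralForm, AddMonoidAlgebra.single_mul_single]
  simp [AddMonoidAlgebra.one_def]

lemma constantCoeff_invForms_one :
    MvPowerSeries.constantCoeff (invForms k d 1) =
      AddMonoidAlgebra.single (-fun i => (d i : ℤ)) 1 := by
  have h : ∀ s : Finset (Fin m), ∏ i ∈ s, (AddMonoidAlgebra.single (-Pi.single i (d i : ℤ)) 1 :
      Laurent k m) = AddMonoidAlgebra.single (∑ i ∈ s, -Pi.single i (d i : ℤ)) 1 := by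
    intro s
    classical
    induction s using Finset.induction_on with
    | empty => simp [AddMonoidAlgebra.one_def]
    | insert a s ha ih =>
      rw [Finset.prod_insert ha, Finset.sum_insert ha, ih, AddMonoidAlgebra.single_mul_single,
        mul_one]
  simp only [invForms, Pi.one_apply, pow_one, map_prod, constantCoeff_inv_formUnit, h]
  congr 1
  rw [Finset.sum_neg_distrib]
  congr 1
  ext i
  simp [Finset.sum_apply, Pi.single_apply]

/-! ### The residue -/

/-- The residue of `F / (g_1 ⋯ g_m)`: the coefficient of `(x_1 ⋯ x_m)⁻¹` in its expansion at the
forms `x_i ^ d_i`. -/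
def residue (F : MvPolynomial (Fin m) (CoeffRing k d)) : MvPowerSeries (Index d) k :=
  xcoeff (-1) (expansion k d F * invForms k d 1)

lemma residue_add (F G : MvPolynomial (Fin m) (CoeffRing k d)) :
    residue k d (F + G) = residue k d F + residue k d G := by
  simp [residue, add_mul]

lemma residue_C_mul (c : CoeffRing k d) (F : MvPolynomial (Fin m) (CoeffRing k d)) :
    residue k d (MvPolynomial.C c * F) = taylor k d c * residue k d F := by
  rw [residue, map_mul (expansion k d), expansion_C, mul_assoc, xcoeff_incl_mul, residue]

lemma residue_sum {α : Type*} (s : Finset α) (F : α → MvPolynomial (Fin m) (CoeffRing k d)) :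
    residue k d (∑ a ∈ s, F a) = ∑ a ∈ s, residue k d (F a) := by
  simp [residue, Finset.sum_mul]

lemma expansion_mem_nonnegSeries (j : Fin m) (F : MvPolynomial (Fin m) (CoeffRing k d)) :
    expansion k d F ∈ nonnegSeries k (Index d) j := by
  induction F using MvPolynomial.induction_on with
  | C c => rw [expansion_C]; exact incl_mem_nonnegSeries j _
  | add F G hF hG => rw [map_add]; exact add_mem hF hG
  | mul_X F i hF =>
    rw [map_mul, expansion_X]
    refine mul_mem hF (xpow_mem_nonnegSeries ?_)
    by_cases h : j = i
    · subst h; simp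
    · simp [h]

lemma _root_.Units.mul_prod_inv {α B : Type*} [CommRing B] [Fintype α] [DecidableEq α]
    (u : α → Bˣ) (j : α) :
    (u j : B) * ∏ i, (((u i)⁻¹ : Bˣ) : B) = ∏ i ∈ Finset.univ.erase j, (((u i)⁻¹ : Bˣ) : B) := by
  rw [← Finset.mul_prod_erase _ _ (Finset.mem_univ j), ← mul_assoc, Units.mul_inv, one_mul]

lemma inv_formUnit_mem_nonnegSeries {i j : Fin m} (hij : i ≠ j) :
    (((formUnit k d i)⁻¹ : (MvPowerSeries (Index d) (Laurent k m))ˣ) :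
      MvPowerSeries (Index d) (Laurent k m)) ∈ nonnegSeries k (Index d) j := by
  refine mem_nonnegSeries_of_mul_eq_one (f := expansion k d (integralForm k d i))
    (v := Pi.single i (d i : ℤ)) (expansion_mem_nonnegSeries k d j _)
    (constantCoeff_expansion_integralForm k d i) (Pi.single_eq_of_ne hij.symm _) ?_
  rw [← val_formUnit, Units.mul_inv]

/-- After cancelling `g_j`, the variable `x_j` occurs only with nonnegative exponents. -/
lemma residue_mul_integralForm (j : Fin m) (F : MvPolynomial (Fin m) (CoeffRing k d)) :
    residue k d (F * integralForm k d j) = 0 := by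
  have h : expansion k d (F * integralForm k d j) * invForms k d 1 =
      expansion k d F * ∏ i ∈ Finset.univ.erase j,
        (((formUnit k d i)⁻¹ : (MvPowerSeries (Index d) (Laurent k m))ˣ) :
          MvPowerSeries (Index d) (Laurent k m)) := by
    rw [← Units.mul_prod_inv, map_mul, ← val_formUnit, mul_assoc]
    simp only [invForms, Pi.one_apply, pow_one]
  have h1 : (-1 : Fin m → ℤ) j < 0 := by rw [Pi.neg_apply, Pi.one_apply]; lia
  rw [residue, h]
  exact xcoeff_eq_zero_of_mem_nonnegSeries (mul_mem (expansion_mem_nonnegSeries k d j F)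
    (prod_mem fun i hi => inv_formUnit_mem_nonnegSeries k d (Finset.ne_of_mem_erase hi))) h1

lemma residue_eq_zero_of_mem {F : MvPolynomial (Fin m) (CoeffRing k d)}
    (hF : F ∈ integralIdeal k d) : residue k d F = 0 := by
  obtain ⟨c, rfl⟩ := (Ideal.mem_span_range_iff_exists_fun).mp hF
  rw [residue_sum]
  exact Finset.sum_eq_zero fun j _ => residue_mul_integralForm k d j (c j)

open Classical in
lemma constantCoeff_residue_monomial (u : Fin m →₀ ℕ) :
    MvPowerSeries.constantCoeff (residue k d (MvPolynomial.monomial u 1)) =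
      if ∀ i, u i + 1 = d i then 1 else 0 := by
  rw [residue, ← MvPowerSeries.coeff_zero_eq_constantCoeff_apply, coeff_xcoeff,
    MvPowerSeries.coeff_zero_eq_constantCoeff_apply, map_mul, constantCoeff_invForms_one,
    expansion_monomial]
  simp only [map_one, one_mul, xpow, MvPowerSeries.constantCoeff_C,
    AddMonoidAlgebra.single_mul_single, AddMonoidAlgebra.coeff_single, Finsupp.single_apply]
  refine if_congr ?_ rfl rfl
  rw [funext_iff]
  refine forall_congr' fun i => ?_
  simp only [Pi.add_apply, Pi.neg_apply, toInt_apply, Pi.one_apply]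
  lia

end GenericForms

/-! ### Differential operators in the coefficients -/

section DifferentialOperators

variable (k : Type*) [Field k] {m : ℕ} (d : Fin m → ℕ)

lemma pderiv_incl_C {k : Type*} [Field k] {σ : Type*} {m : ℕ} (j : σ) (c : k) :
    MvPowerSeries.pderiv (Laurent k m) j (incl (MvPowerSeries.C c)) = 0 := by
  rw [incl, MvPowerSeries.map_C]
  exact MvPowerSeries.pderiv_C

lemma pderiv_expansion_integralForm (j : Index d) (i : Fin m) :
    MvPowerSeries.pderiv (Laurent k m) j (expansion k d (integralForm k d i)) =
      if j.1 = i then xpow (toInt j.2.1) else 0 := by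
  classical
  rw [expansion_integralForm, map_sum]
  have h : ∀ r : {r : Fin m →₀ ℕ // r ∈ Finset.finsuppAntidiag Finset.univ (d i)},
      MvPowerSeries.pderiv (Laurent k m) j
        (incl (MvPowerSeries.X ⟨i, r⟩ + MvPowerSeries.C (basePoint k d ⟨i, r⟩)) *
          xpow (toInt r.1)) = if (⟨i, r⟩ : Index d) = j then xpow (toInt r.1) else 0 := by
    intro r
    rw [Derivation.leibniz, pderiv_xpow, map_add, map_add, pderiv_incl_C, pderiv_incl_X]
    split_ifs <;> simp
  rw [Finset.sum_congr rfl fun r _ => h r]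
  obtain ⟨i', r'⟩ := j
  split_ifs with hi
  · dsimp only at hi
    subst hi
    rw [Finset.sum_eq_single r']
    · simp
    · intro r _ hr
      rw [if_neg]
      simpa using hr
    · simp
  · refine Finset.sum_eq_zero fun r _ => if_neg ?_
    intro h
    exact hi (congrArg Sigma.fst h).symm

lemma pderiv_inv_formUnit (j : Index d) (i : Fin m) :
    MvPowerSeries.pderiv (Laurent k m) j
      (((formUnit k d i)⁻¹ : (MvPowerSeries (Index d) (Laurent k m))ˣ) :
        MvPowerSeries (Index d) (Laurent k m)) =
      if j.1 = i then
        -(((formUnit k d i)⁻¹ : (MvPowerSeries (Index d) (Laurent k m))ˣ) :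
          MvPowerSeries (Index d) (Laurent k m)) ^ 2 * xpow (toInt j.2.1) else 0 := by
  rw [MvPowerSeries.pderiv_inv, val_formUnit, pderiv_expansion_integralForm, mul_ite, mul_zero]

lemma _root_.Derivation.prod_eq_zero {R A α : Type*} [CommRing R] [CommRing A] [Algebra R A]
    (D : Derivation R A A) (s : Finset α) (f : α → A) (h : ∀ a ∈ s, D (f a) = 0) :
    D (∏ a ∈ s, f a) = 0 := by
  refine Finset.prod_induction f (fun x => D x = 0) ?_ D.map_one_eq_zero h
  intro x y hx hy
  rw [D.leibniz, hx, hy, smul_zero, smul_zero, add_zero]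

lemma pderiv_invForms (j : Index d) (e : Fin m → ℕ) :
    MvPowerSeries.pderiv (Laurent k m) j (invForms k d e) =
      -((e j.1 : MvPowerSeries (Index d) (Laurent k m)) * xpow (toInt j.2.1) *
        invForms k d (e + Pi.single j.1 1)) := by
  classical
  have h0 : MvPowerSeries.pderiv (Laurent k m) j (∏ i ∈ Finset.univ.erase j.1,
      (((formUnit k d i)⁻¹ : (MvPowerSeries (Index d) (Laurent k m))ˣ) :
        MvPowerSeries (Index d) (Laurent k m)) ^ e i) = 0 := by
    refine Derivation.prod_eq_zero _ _ _ fun i hi => ?_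
    rw [MvPowerSeries.pderiv_pow, pderiv_inv_formUnit, if_neg (Finset.ne_of_mem_erase hi).symm,
      mul_zero]
  have h1 : ∀ e' : Fin m → ℕ, invForms k d e' =
      (((formUnit k d j.1)⁻¹ : (MvPowerSeries (Index d) (Laurent k m))ˣ) :
        MvPowerSeries (Index d) (Laurent k m)) ^ e' j.1 * ∏ i ∈ Finset.univ.erase j.1,
      (((formUnit k d i)⁻¹ : (MvPowerSeries (Index d) (Laurent k m))ˣ) :
        MvPowerSeries (Index d) (Laurent k m)) ^ e' i :=
    fun e' => (Finset.mul_prod_erase _ _ (Finset.mem_univ j.1)).symm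
  have h2 : ∏ i ∈ Finset.univ.erase j.1,
      (((formUnit k d i)⁻¹ : (MvPowerSeries (Index d) (Laurent k m))ˣ) :
        MvPowerSeries (Index d) (Laurent k m)) ^ (e + Pi.single j.1 1 : Fin m → ℕ) i =
      ∏ i ∈ Finset.univ.erase j.1,
      (((formUnit k d i)⁻¹ : (MvPowerSeries (Index d) (Laurent k m))ˣ) :
        MvPowerSeries (Index d) (Laurent k m)) ^ e i := by
    refine Finset.prod_congr rfl fun i hi => ?_
    rw [Pi.add_apply, Pi.single_eq_of_ne (Finset.ne_of_mem_erase hi), add_zero]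
  rw [h1, h1, Derivation.leibniz, h0, h2, MvPowerSeries.pderiv_pow,
    pderiv_inv_formUnit, if_pos rfl, Pi.add_apply, Pi.single_eq_same]
  generalize (∏ i ∈ Finset.univ.erase j.1,
      (((formUnit k d i)⁻¹ : (MvPowerSeries (Index d) (Laurent k m))ˣ) :
        MvPowerSeries (Index d) (Laurent k m)) ^ e i) = P
  generalize (((formUnit k d j.1)⁻¹ : (MvPowerSeries (Index d) (Laurent k m))ˣ) :
        MvPowerSeries (Index d) (Laurent k m)) = u
  rcases Nat.eq_zero_or_pos (e j.1) with he | he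
  · simp [he]
  · obtain ⟨n, hn⟩ := Nat.exists_eq_succ_of_ne_zero he.ne'
    rw [hn]
    simp only [smul_eq_mul, mul_zero, zero_add, Nat.succ_eq_add_one, Nat.add_sub_cancel]
    ring

/-- A monomial `x ^ N` of degree `∑ d i`, where `i` runs over the multiset `s`, is a product of
monomials of degrees `d i`. Differentiating `1 / (g_1 ⋯ g_m)` with respect to the corresponding
coefficients yields a nonzero multiple of `x ^ N / ∏ g_i ^ (1 + count i s)`, as long as the
exponents in the denominator do not exceed `p`. The operator is given by its action `D` on the
power series over the Laurent polynomials and its action `D'` on the coefficients of the `x ^ v`;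
it is linear over the elements `y` that all derivations kill, such as `p`-th powers. -/
lemma exists_diffOp (p : ℕ) [Fact p.Prime] [CharP k p] (s : Multiset (Fin m))
    (hs : ∀ i, s.count i < p) (N : Fin m →₀ ℕ) (hN : N.degree = (s.map d).sum) :
    ∃ (D : MvPowerSeries (Index d) (Laurent k m) →+ MvPowerSeries (Index d) (Laurent k m))
      (D' : MvPowerSeries (Index d) k →+ MvPowerSeries (Index d) k) (c : k), c ≠ 0 ∧
      (∀ v f, xcoeff v (D f) = D' (xcoeff v f)) ∧
      (∀ y f, (∀ j, MvPowerSeries.pderiv (Laurent k m) j y = 0) → D (y * f) = y * D f) ∧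
      D (invForms k d 1) = incl (MvPowerSeries.C c) * xpow (toInt N) *
        invForms k d (fun i => 1 + s.count i) := by
  induction s using Multiset.induction_on generalizing N with
  | empty =>
    have hN0 : N = 0 := by simpa [Finsupp.degree_eq_zero_iff] using hN
    subst hN0
    refine ⟨AddMonoidHom.id _, AddMonoidHom.id _, 1, one_ne_zero, fun _ _ => rfl,
      fun _ _ _ => rfl, ?_⟩
    have h : toInt (0 : Fin m →₀ ℕ) = 0 := by ext i; simp
    simp only [AddMonoidHom.id_apply, map_one, one_mul, h, xpow_zero, Multiset.count_zero, add_zero]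
    rfl
  | cons i s ih =>
    rw [Multiset.map_cons, Multiset.sum_cons] at hN
    obtain ⟨r, hrN, hr⟩ := Finsupp.exists_le_degree_eq N (d i) (by lia)
    obtain ⟨N, rfl⟩ := exists_add_of_le hrN
    have hr' : r ∈ Finset.finsuppAntidiag Finset.univ (d i) := by
      rw [Finset.mem_finsuppAntidiag, ← hr, Finsupp.degree_eq_sum]
      exact ⟨rfl, Finset.subset_univ _⟩
    rw [map_add, hr] at hN
    obtain ⟨D, D', c, hc, h1, h2, h3⟩ := ih
      (fun a => (Multiset.count_le_count_cons a i s).trans_lt (hs a)) N (by lia)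
    refine ⟨(MvPowerSeries.pderiv (Laurent k m) ⟨i, r, hr'⟩).toLinearMap.toAddMonoidHom.comp D,
      (MvPowerSeries.pderiv k ⟨i, r, hr'⟩).toLinearMap.toAddMonoidHom.comp D',
      -((1 + s.count i : ℕ) : k) * c, ?_, ?_, ?_, ?_⟩
    · refine mul_ne_zero (neg_ne_zero.mpr ?_) hc
      rw [Ne, CharP.cast_eq_zero_iff k p]
      have := hs i
      rw [Multiset.count_cons_self] at this
      exact fun h => absurd (Nat.le_of_dvd (by lia) h) (by lia)
    · intro v f
      change xcoeff v (MvPowerSeries.pderiv (Laurent k m) _ (D f)) =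
        MvPowerSeries.pderiv k _ (D' (xcoeff v f))
      rw [xcoeff_pderiv, h1]
    · intro y f hy
      change MvPowerSeries.pderiv (Laurent k m) _ (D (y * f)) =
        y * MvPowerSeries.pderiv (Laurent k m) _ (D f)
      rw [h2 y f hy, Derivation.leibniz, hy, smul_zero, add_zero, smul_eq_mul]
    · change MvPowerSeries.pderiv (Laurent k m) _ (D (invForms k d 1)) = _
      have hct : (fun a => 1 + s.count a) + Pi.single i 1 = fun a => 1 + (i ::ₘ s).count a := by
        ext a
        by_cases hai : a = i
        · subst hai; simp [add_assoc]
        · simp [hai]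
      rw [h3, Derivation.leibniz, pderiv_invForms, Derivation.leibniz, pderiv_xpow, pderiv_incl_C,
        hct, toInt_add, xpow_add, map_mul, map_neg, map_mul, map_neg, map_natCast, map_natCast]
      simp only [smul_eq_mul, mul_zero, add_zero]
      ring

lemma invForms_const (p : ℕ) : invForms k d (fun _ => p) = invForms k d 1 ^ p := by
  simp [invForms, Finset.prod_pow]

/-- If the residues of all products of `(x₁ + ⋯ + x_m) ^ q * H ^ p` with monomials vanish, then so
do those of the products of `H` with the monomials of the complementary degree `s - h`. The
factor `H ^ p` is a constant for every derivation, so a suitable differential operator in the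
coefficients of the forms turns the former residue into the `p`-th power of the latter. -/
lemma residue_monomial_mul_eq_zero (p : ℕ) [Fact p.Prime] [CharP k p]
    {H : MvPolynomial (Fin m) (CoeffRing k d)} {q h s : ℕ} (hq : q < p) (hs : s + m = ∑ i, d i)
    (hqs : p * h + q ≤ s) (j : Fin m)
    (hH : ∀ t, residue k d (MvPolynomial.monomial t 1 * ((∑ i, MvPolynomial.X i) ^ q * H ^ p)) = 0)
    (w : Fin m →₀ ℕ) (hw : w.degree + h = s) :
    residue k d (MvPolynomial.monomial w 1 * H) = 0 := by
  have hp1 : 1 ≤ p := (Fact.out : p.Prime).one_le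
  have hpw : p * w.degree + p * h = p * s := by rw [← mul_add, hw]
  have hps : s ≤ p * s := Nat.le_mul_of_pos_left s hp1
  obtain ⟨t, htw, ht⟩ := Finsupp.exists_le_degree_eq (p • w) (s - (p * h + q)) (by
    rw [map_nsmul, smul_eq_mul]; lia)
  obtain ⟨t', htt⟩ := exists_add_of_le htw
  -- With `p w = t + t'` and `(p - 1, …, p - 1) = q e_j + o'`, an operator that multiplies by
  -- `x ^ (t' + o')` shifts the exponent `-1 - t` of interest to `p (-1 - w) + q e_j`.
  set ones : Fin m →₀ ℕ := Finsupp.equivFunOnFinite.symm fun _ => p - 1 with hones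
  have hqo : Finsupp.single j q ≤ ones := by
    intro i
    by_cases hij : i = j
    · subst hij; simp [hones]; lia
    · simp [hij]
  obtain ⟨o', ho⟩ := exists_add_of_le hqo
  have hdeg1 : t.degree + t'.degree = p * w.degree := by
    rw [← map_add, ← htt, map_nsmul, smul_eq_mul]
  have hdeg2 : q + o'.degree = m * (p - 1) := by
    have : ones.degree = m * (p - 1) := by simp [Finsupp.degree_eq_sum, hones]
    rw [← this, ho, map_add, Finsupp.degree_single]
  obtain ⟨D, D', c, hc, h1, h2, h3⟩ := exists_diffOp k d p ((p - 1) • Finset.univ.val)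
    (fun i => by
      rw [Multiset.count_nsmul, Multiset.count_eq_one_of_mem Finset.univ.nodup (Finset.mem_univ i)]
      lia) (t' + o') (by
      have : ((Finset.univ : Finset (Fin m)).val.map d).sum = s + m := hs.symm
      rw [Multiset.map_nsmul, Multiset.sum_nsmul, this, map_add, smul_eq_mul]
      obtain ⟨p', rfl⟩ := Nat.exists_eq_add_of_le hp1
      have e1 : 1 + p' - 1 = p' := by lia
      rw [e1] at hdeg2 ⊢
      rw [ht] at hdeg1
      have e2 : (1 + p') * s = s + p' * s := by ring
      have e3 : p' * (s + m) = p' * s + m * p' := by ring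
      lia)
  have hcount : (fun i => 1 + ((p - 1) • Finset.univ.val : Multiset (Fin m)).count i) =
      fun _ => p := by
    ext i
    rw [Multiset.count_nsmul, Multiset.count_eq_one_of_mem Finset.univ.nodup (Finset.mem_univ i)]
    lia
  rw [hcount, invForms_const] at h3
  have hchar : CharP (MvPowerSeries (Index d) (Laurent k m)) p := by
    have : CharP (Laurent k m) p := charP_of_injective_algebraMap
      (algebraMap k (Laurent k m)).injective p
    exact charP_of_injective_ringHom (f := MvPowerSeries.C) MvPowerSeries.C_injective p
  set y : MvPowerSeries (Index d) (Laurent k m) :=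
    xpow (toInt t) * ((∑ i, xpow (Pi.single i 1)) ^ q * expansion k d H ^ p) with hy
  have hyD : ∀ i, MvPowerSeries.pderiv (Laurent k m) i y = 0 := by
    intro i
    have e1 : MvPowerSeries.pderiv (Laurent k m) i (expansion k d H ^ p) = 0 := by
      rw [MvPowerSeries.pderiv_pow, CharP.cast_eq_zero, zero_mul, zero_mul]
    have e2 : MvPowerSeries.pderiv (Laurent k m) i
        ((∑ i, xpow (Pi.single i 1) : MvPowerSeries (Index d) (Laurent k m)) ^ q) = 0 := by
      rw [MvPowerSeries.pderiv_pow, map_sum, Finset.sum_eq_zero fun i _ => pderiv_xpow _ _,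
        mul_zero]
    rw [hy, Derivation.leibniz, Derivation.leibniz, e1, e2, pderiv_xpow]
    simp only [smul_zero, add_zero]
  have hres := hH t
  rw [residue, map_mul (expansion k d), map_mul (expansion k d), map_pow, map_pow, map_sum,
    Finset.sum_congr rfl fun i _ => expansion_X k d i, expansion_monomial, map_one, map_one,
    one_mul] at hres
  have hD := h1 (-1) (y * invForms k d 1)
  have hvec : (-1 - toInt t - toInt (t' + o') : Fin m → ℤ) =
      p • (-1 - toInt w) + Pi.single j (q : ℤ) := by
    ext i
    have e1 := DFunLike.congr_fun htt i
    have e2 := DFunLike.congr_fun ho i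
    have e3 : (Pi.single j (q : ℤ) : Fin m → ℤ) i = ((Finsupp.single j q i : ℕ) : ℤ) := by
      by_cases hij : i = j
      · subst hij; simp
      · simp [hij]
    simp only [Finsupp.smul_apply, Finsupp.add_apply, smul_eq_mul] at e1 e2
    simp only [Pi.add_apply, Pi.sub_apply, Pi.neg_apply, Pi.one_apply, Pi.smul_apply, toInt_apply,
      Finsupp.add_apply, e3]
    have e4 : ones i = p - 1 := rfl
    rw [e4] at e2
    zify [hp1] at e1 e2
    rw [nsmul_eq_mul]
    push_cast
    linear_combination e1 + e2
  rw [hres, map_zero, h2 y _ hyD, h3, hy] at hD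
  have hcalc : xpow (toInt t) * ((∑ i, xpow (Pi.single i 1)) ^ q * expansion k d H ^ p) *
      (incl (MvPowerSeries.C c) * xpow (toInt (t' + o')) * invForms k d 1 ^ p) =
      incl (MvPowerSeries.C c) * (xpow (toInt t) * (xpow (toInt (t' + o')) *
        ((∑ i, xpow (Pi.single i 1)) ^ q * (expansion k d H * invForms k d 1) ^ p))) := by
    ring
  rw [hcalc, xcoeff_incl_mul, xcoeff_xpow_mul, xcoeff_xpow_mul, hvec,
    xcoeff_sum_pow_mul_pow_char p _ _ _ hq] at hD
  have hC : (MvPowerSeries.C c : MvPowerSeries (Index d) k) ≠ 0 := by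
    rw [Ne, ← map_zero MvPowerSeries.C]
    exact fun h => hc (MvPowerSeries.C_injective h)
  rw [residue, map_mul (expansion k d), expansion_monomial, map_one, map_one, one_mul, mul_assoc,
    xcoeff_xpow_mul]
  exact eq_zero_of_pow_eq_zero ((mul_eq_zero.mp hD).resolve_left hC)

end DifferentialOperators

/-! ### Monomial bases and the residue pairing -/

section Duality

variable (k : Type*) [Field k] {m : ℕ} (d : Fin m → ℕ)

/-- The exponent vectors `u` of degree `n` with `u i < d i` for all `i`: they index a basis of the
degree `n` piece of the complete intersection. -/
def box (n : ℕ) : Finset (Fin m →₀ ℕ) :=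
  {u ∈ Finset.finsuppAntidiag Finset.univ n | ∀ i, u i < d i}

variable {d} in
lemma mem_box {n : ℕ} {u : Fin m →₀ ℕ} : u ∈ box d n ↔ u.degree = n ∧ ∀ i, u i < d i := by
  simp [box, Finset.mem_finsuppAntidiag, Finsupp.degree_eq_sum]

lemma box_eq_empty {s n : ℕ} (hs : s + m = ∑ i, d i) (hn : s < n) : box d n = ∅ := by
  rw [Finset.eq_empty_iff_forall_notMem]
  intro u hu
  obtain ⟨h1, h2⟩ := mem_box.mp hu
  have : ∑ i, (u i + 1) ≤ ∑ i, d i := Finset.sum_le_sum fun i _ => h2 i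
  rw [Finset.sum_add_distrib, ← Finsupp.degree_eq_sum, h1] at this
  simp at this
  lia

/-- The exponent vector `d - 1 - u`. -/
def complement (u : Fin m →₀ ℕ) : Fin m →₀ ℕ := Finsupp.equivFunOnFinite.symm fun i => d i - 1 - u i

@[simp] lemma complement_apply (u : Fin m →₀ ℕ) (i : Fin m) :
    complement d u i = d i - 1 - u i := rfl

lemma degree_complement {s n : ℕ} (hs : s + m = ∑ i, d i) {u : Fin m →₀ ℕ} (hu : u ∈ box d n) :
    (complement d u).degree + n = s := by
  obtain ⟨h1, h2⟩ := mem_box.mp hu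
  have h3 : ∑ i, (complement d u i + u i + 1) = ∑ i, d i :=
    Finset.sum_congr rfl fun i _ => by have := h2 i; simp; lia
  rw [Finset.sum_add_distrib, Finset.sum_add_distrib, ← Finsupp.degree_eq_sum,
    ← Finsupp.degree_eq_sum, h1] at h3
  simp at h3
  lia

lemma card_box_eq {s n n' : ℕ} (hs : s + m = ∑ i, d i) (hn : n + n' = s) :
    (box d n).card = (box d n').card := by
  have key : ∀ {a b : ℕ}, a + b = s → ∀ u ∈ box d a, complement d u ∈ box d b := by
    intro a b hab u hu
    rw [mem_box]
    refine ⟨by have := degree_complement d hs hu; lia, fun i => ?_⟩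
    have := (mem_box.mp hu).2 i
    simp; lia
  have key2 : ∀ {a : ℕ}, ∀ u ∈ box d a, complement d (complement d u) = u := by
    intro a u hu
    ext i
    have := (mem_box.mp hu).2 i
    simp; lia
  exact Finset.card_bij' (fun u _ => complement d u) (fun u _ => complement d u)
    (key hn) (key (by lia)) key2 key2

/-- Specialization of the generic forms to `x_i ^ d_i`. -/
def specialize : CoeffRing k d →+* k := MvPowerSeries.constantCoeff.comp (taylor k d).toRingHom

lemma specialize_X (j : Index d) : specialize k d (MvPolynomial.X j) = basePoint k d j := by
  change MvPowerSeries.constantCoeff (taylor k d (MvPolynomial.X j)) = _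
  rw [taylor_X]
  simp

lemma map_specialize_integralForm (i : Fin m) :
    MvPolynomial.map (specialize k d) (integralForm k d i) =
      MvPolynomial.monomial (Finsupp.single i (d i)) 1 := by
  rw [integralForm, map_sum,
    Finset.sum_eq_single ⟨Finsupp.single i (d i), single_mem_finsuppAntidiag i (d i)⟩]
  · simp [specialize_X, basePoint]
  · intro r _ hr
    have : r.1 ≠ Finsupp.single i (d i) := fun h => hr (Subtype.ext h)
    simp [specialize_X, basePoint, this]
  · simp

lemma integralForm_isHomogeneous (i : Fin m) : (integralForm k d i).IsHomogeneous (d i) := by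
  refine MvPolynomial.IsHomogeneous.sum _ _ _ fun r _ => ?_
  refine MvPolynomial.isHomogeneous_monomial _ ?_
  have := r.2
  rw [Finset.mem_finsuppAntidiag] at this
  rw [Finsupp.degree_eq_sum]
  exact this.1

lemma mem_finsuppAntidiag_univ {n : ℕ} {u : Fin m →₀ ℕ} :
    u ∈ Finset.finsuppAntidiag Finset.univ n ↔ u.degree = n := by
  simp [Finset.mem_finsuppAntidiag, Finsupp.degree_eq_sum]

/-- The exponent vectors of the monomials of degree `n` in `m` variables. -/
abbrev DegreeMonomial (m n : ℕ) : Type :=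
  {v : Fin m →₀ ℕ // v ∈ Finset.finsuppAntidiag Finset.univ n}

lemma _root_.MvPolynomial.IsHomogeneous.eq_sum_finsuppAntidiag {B : Type*} [CommRing B] {n : ℕ}
    {F : MvPolynomial (Fin m) B} (hF : F.IsHomogeneous n) :
    F = ∑ v : DegreeMonomial m n, F.coeff v.1 • MvPolynomial.monomial v.1 (1 : B) := by
  rw [Finset.sum_coe_sort (Finset.finsuppAntidiag Finset.univ n)
    (fun v => F.coeff v • MvPolynomial.monomial v (1 : B))]
  conv_lhs => rw [F.as_sum]
  refine (Finset.sum_subset ?_ ?_).trans (Finset.sum_congr rfl fun v _ => ?_)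
  · intro v hv
    rw [mem_finsuppAntidiag_univ]
    rw [Finsupp.degree_eq_weight_one]
    exact hF (MvPolynomial.mem_support_iff.mp hv)
  · intro v _ hv
    rw [MvPolynomial.notMem_support_iff.mp hv, MvPolynomial.monomial_zero]
  · simp [MvPolynomial.smul_monomial]

open Classical in
/-- A monomial of degree `n` that is divisible by some `x_j ^ d_j` is replaced by the corresponding
multiple of `g_j`; the other monomials are kept. -/
def reducedForm (v : Fin m →₀ ℕ) : MvPolynomial (Fin m) (CoeffRing k d) :=
  if h : ∃ j, d j ≤ v j then
    MvPolynomial.monomial (v - Finsupp.single h.choose (d h.choose)) 1 *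
      integralForm k d h.choose
  else MvPolynomial.monomial v 1

lemma single_choose_le {v : Fin m →₀ ℕ} (h : ∃ j, d j ≤ v j) :
    Finsupp.single h.choose (d h.choose) ≤ v := by
  intro i
  by_cases hi : i = h.choose
  · rw [hi, Finsupp.single_eq_same]; exact h.choose_spec
  · simp [hi]

lemma reducedForm_isHomogeneous (v : Fin m →₀ ℕ) : (reducedForm k d v).IsHomogeneous v.degree := by
  rw [reducedForm]
  split_ifs with h
  · obtain ⟨w, hw⟩ := exists_add_of_le (single_choose_le d h)
    have h1 : v.degree = w.degree + d h.choose := by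
      conv_lhs => rw [hw]
      rw [map_add, Finsupp.degree_single, add_comm]
    have h2 : v - Finsupp.single h.choose (d h.choose) = w := by
      exact tsub_eq_of_eq_add_rev hw
    rw [h1, h2]
    exact (MvPolynomial.isHomogeneous_monomial _ rfl).mul (integralForm_isHomogeneous k d _)
  · exact MvPolynomial.isHomogeneous_monomial _ rfl

lemma map_specialize_reducedForm (v : Fin m →₀ ℕ) :
    MvPolynomial.map (specialize k d) (reducedForm k d v) = MvPolynomial.monomial v 1 := by
  rw [reducedForm]
  split_ifs with h
  · rw [map_mul, map_specialize_integralForm, MvPolynomial.map_monomial,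
      MvPolynomial.monomial_mul, map_one, mul_one,
      tsub_add_cancel_of_le (single_choose_le d h)]
  · rw [MvPolynomial.map_monomial, map_one]

/-- Up to a nonzero constant, every form of degree `n` is a combination of the monomials in the
box modulo the ideal: the matrix expressing the reduced forms through the monomials specializes to
the identity matrix, so it is invertible over the field of fractions. -/
lemma exists_smul_mem (n : ℕ) : ∃ δ : CoeffRing k d, δ ≠ 0 ∧
    ∀ F : MvPolynomial (Fin m) (CoeffRing k d), F.IsHomogeneous n →
      ∃ c : (Fin m →₀ ℕ) → CoeffRing k d,
        MvPolynomial.C δ * F - ∑ u ∈ box d n, MvPolynomial.monomial u (c u) ∈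
          integralIdeal k d := by
  classical
  let P : Matrix (DegreeMonomial m n) (DegreeMonomial m n) (CoeffRing k d) :=
    fun v w => (reducedForm k d v.1).coeff w.1
  have hP : (specialize k d).mapMatrix P = 1 := by
    ext v w
    rw [RingHom.mapMatrix_apply, Matrix.map_apply]
    change specialize k d ((reducedForm k d v.1).coeff w.1) = _
    rw [← MvPolynomial.coeff_map, map_specialize_reducedForm, MvPolynomial.coeff_monomial,
      Matrix.one_apply]
    exact if_congr Subtype.ext_iff.symm rfl rfl
  have hdet : P.det ≠ 0 := by
    intro h
    have := RingHom.map_det (specialize k d) P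
    rw [hP, h, map_zero, Matrix.det_one] at this
    exact zero_ne_one this
  refine ⟨P.det, hdet, fun F hF => ?_⟩
  let N : Submodule (CoeffRing k d) (MvPolynomial (Fin m) (CoeffRing k d)) :=
    (integralIdeal k d).restrictScalars _ ⊔ Submodule.span _
      ((fun u => MvPolynomial.monomial u (1 : CoeffRing k d)) '' (box d n : Set (Fin m →₀ ℕ)))
  have hrow : ∀ v : DegreeMonomial m n, reducedForm k d v.1 ∈ N := by
    intro v
    rw [reducedForm]
    split_ifs with h
    · exact Submodule.mem_sup_left
        (Ideal.mul_mem_left _ _ (Ideal.subset_span ⟨_, rfl⟩))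
    · push Not at h
      exact Submodule.mem_sup_right (Submodule.subset_span
        ⟨v.1, mem_box.mpr ⟨mem_finsuppAntidiag_univ.mp v.2, h⟩, rfl⟩)
  have hmon : ∀ v : DegreeMonomial m n,
      P.det • MvPolynomial.monomial v.1 (1 : CoeffRing k d) ∈ N := by
    intro v
    have h1 : ∑ v' : DegreeMonomial m n, P.adjugate v v' • reducedForm k d v'.1 =
        P.det • MvPolynomial.monomial v.1 (1 : CoeffRing k d) := by
      have h2 : ∀ v' : DegreeMonomial m n, reducedForm k d v'.1 =
          ∑ w : DegreeMonomial m n, P v' w • MvPolynomial.monomial w.1 (1 : CoeffRing k d) := by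
        intro v'
        refine MvPolynomial.IsHomogeneous.eq_sum_finsuppAntidiag ?_
        have := reducedForm_isHomogeneous k d v'.1
        rwa [mem_finsuppAntidiag_univ.mp v'.2] at this
      have h3 : ∀ w : DegreeMonomial m n,
          ∑ v' : DegreeMonomial m n, P.adjugate v v' * P v' w = if v = w then P.det else 0 := by
        intro w
        have := congrFun (congrFun P.adjugate_mul v) w
        rw [Matrix.mul_apply, Matrix.smul_apply, Matrix.one_apply] at this
        simpa using this
      rw [Finset.sum_congr rfl fun v' _ => by rw [h2 v', Finset.smul_sum], Finset.sum_comm]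
      simp_rw [smul_smul, ← Finset.sum_smul, h3, ite_smul, zero_smul]
      simp
    rw [← h1]
    exact Submodule.sum_mem _ fun v' _ => N.smul_mem _ (hrow v')
  have hFN : P.det • F ∈ N := by
    rw [hF.eq_sum_finsuppAntidiag, Finset.smul_sum]
    refine Submodule.sum_mem _ fun v _ => ?_
    rw [smul_comm]
    exact N.smul_mem _ (hmon v)
  obtain ⟨a, ha, b, hb, hab⟩ := Submodule.mem_sup.mp hFN
  rw [Submodule.mem_span_image_finset_iff_exists_fun] at hb
  obtain ⟨c, hc⟩ := hb
  refine ⟨fun u => if hu : u ∈ box d n then c ⟨u, hu⟩ else 0, ?_⟩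
  have hsum : ∑ u ∈ box d n, MvPolynomial.monomial u
      (if hu : u ∈ box d n then c ⟨u, hu⟩ else 0) = b := by
    rw [← hc, ← Finset.sum_coe_sort]
    refine Finset.sum_congr rfl fun u _ => ?_
    simp [MvPolynomial.smul_monomial]
  rw [← MvPolynomial.smul_eq_C_mul, ← hab, hsum, add_sub_cancel_right]
  exact ha

/-- The residue pairing on the monomials in the box is nondegenerate, since its matrix specializes
to the identity matrix. -/
lemma eq_zero_of_residue_sum_box {s n : ℕ} (hs : s + m = ∑ i, d i)
    (c : (Fin m →₀ ℕ) → CoeffRing k d)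
    (hc : ∀ w : Fin m →₀ ℕ, w.degree + n = s → residue k d (MvPolynomial.monomial w 1 *
      ∑ u ∈ box d n, MvPolynomial.monomial u (c u)) = 0) :
    ∀ u ∈ box d n, c u = 0 := by
  classical
  let Q : Matrix (box d n) (box d n) (MvPowerSeries (Index d) k) := fun u u' =>
    residue k d (MvPolynomial.monomial (complement d u'.1 + u.1) 1)
  have hQ : (MvPowerSeries.constantCoeff (σ := Index d) (R := k)).mapMatrix Q = 1 := by
    ext u u'
    rw [RingHom.mapMatrix_apply, Matrix.map_apply]
    change MvPowerSeries.constantCoeff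
      (residue k d (MvPolynomial.monomial (complement d u'.1 + u.1) 1)) = _
    rw [constantCoeff_residue_monomial, Matrix.one_apply]
    refine if_congr ?_ rfl rfl
    rw [Subtype.ext_iff, DFunLike.ext_iff]
    refine forall_congr' fun i => ?_
    have := (mem_box.mp u'.2).2 i
    simp only [Finsupp.add_apply, complement_apply]
    lia
  have hdet : Q.det ≠ 0 := by
    intro h
    have := RingHom.map_det (MvPowerSeries.constantCoeff (σ := Index d) (R := k)) Q
    rw [hQ, h, map_zero, Matrix.det_one] at this
    exact zero_ne_one this
  have hv : Matrix.vecMul (fun u : box d n => taylor k d (c u.1)) Q = 0 := by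
    ext1 u'
    rw [Pi.zero_apply, ← hc (complement d u'.1) (degree_complement d hs u'.2), Finset.mul_sum,
      residue_sum, ← Finset.sum_coe_sort (box d n)]
    refine Finset.sum_congr rfl fun u _ => ?_
    rw [MvPolynomial.monomial_mul, one_mul]
    have h1 : MvPolynomial.monomial (complement d u'.1 + u.1) (c u.1) =
        MvPolynomial.C (c u.1) * MvPolynomial.monomial (complement d u'.1 + u.1) 1 := by
      rw [MvPolynomial.C_mul_monomial, mul_one]
    rw [h1, residue_C_mul]
  intro u hu
  have h1 := congrFun (Matrix.eq_zero_of_vecMul_eq_zero hdet hv) ⟨u, hu⟩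
  exact taylor_injective k d (h1.trans (map_zero _).symm)

/-- A form that is orthogonal to all monomials of the complementary degree under the residue
pairing lies in the ideal, up to a nonzero constant. -/
lemma exists_C_mul_mem_of_residue {s n : ℕ} (hs : s + m = ∑ i, d i)
    {F : MvPolynomial (Fin m) (CoeffRing k d)} (hF : F.IsHomogeneous n)
    (h : ∀ w : Fin m →₀ ℕ, w.degree + n = s → residue k d (MvPolynomial.monomial w 1 * F) = 0) :
    ∃ δ : CoeffRing k d, δ ≠ 0 ∧ MvPolynomial.C δ * F ∈ integralIdeal k d := by
  obtain ⟨δ, hδ, hspan⟩ := exists_smul_mem k d n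
  obtain ⟨c, hc⟩ := hspan F hF
  refine ⟨δ, hδ, ?_⟩
  have h0 : ∀ u ∈ box d n, c u = 0 := by
    refine eq_zero_of_residue_sum_box k d hs c fun w hw => ?_
    have h1 := residue_eq_zero_of_mem k d
      (Ideal.mul_mem_left _ (MvPolynomial.monomial w (-1)) hc)
    have h2 : MvPolynomial.monomial w 1 * ∑ u ∈ box d n, MvPolynomial.monomial u (c u) =
        MvPolynomial.monomial w (-1) * (MvPolynomial.C δ * F -
          ∑ u ∈ box d n, MvPolynomial.monomial u (c u)) +
        MvPolynomial.C δ * (MvPolynomial.monomial w 1 * F) := by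
      rw [map_neg]
      ring
    rw [h2, residue_add, h1, residue_C_mul, h w hw, mul_zero, add_zero]
  rwa [Finset.sum_eq_zero fun u hu => by rw [h0 u hu, MvPolynomial.monomial_zero], sub_zero] at hc

end Duality

/-! ### Passage to the field of rational functions -/

section FractionField

variable (k : Type*) [Field k] {m : ℕ} (d : Fin m → ℕ)

/-- Extension of coefficients from `k[a]` to `k(a)`. -/
abbrev toField : MvPolynomial (Fin m) (CoeffRing k d) →+* MvPolynomial (Fin m) (CoeffField k d) :=
  MvPolynomial.map (algebraMap (CoeffRing k d) (CoeffField k d))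

lemma toField_integralForm (i : Fin m) : toField k d (integralForm k d i) = genericForm k d i := by
  simp [toField, integralForm, genericForm, coeffVar]

lemma genericIdeal_eq_map : genericIdeal k d = (integralIdeal k d).map (toField k d) := by
  rw [integralIdeal, Ideal.map_span, ← Set.range_comp, genericIdeal]
  congr 2
  ext1 i
  exact (toField_integralForm k d i).symm

attribute [local instance] MvPolynomial.algebraMvPolynomial in
lemma toField_mem_genericIdeal_iff {F : MvPolynomial (Fin m) (CoeffRing k d)} :
    toField k d F ∈ genericIdeal k d ↔
      ∃ δ : CoeffRing k d, δ ≠ 0 ∧ MvPolynomial.C δ * F ∈ integralIdeal k d := by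
  have h := IsLocalization.algebraMap_mem_map_algebraMap_iff
    (S := MvPolynomial (Fin m) (CoeffField k d))
    ((nonZeroDivisors (CoeffRing k d)).map (MvPolynomial.C (σ := Fin m))) (integralIdeal k d) F
  rw [genericIdeal_eq_map]
  refine Iff.trans h ⟨?_, ?_⟩
  · rintro ⟨_, ⟨δ, hδ, rfl⟩, h⟩
    exact ⟨δ, nonZeroDivisors.ne_zero hδ, h⟩
  · rintro ⟨δ, hδ, h⟩
    exact ⟨_, ⟨δ, mem_nonZeroDivisors_of_ne_zero hδ, rfl⟩, h⟩

attribute [local instance] MvPolynomial.algebraMvPolynomial in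
/-- Clearing denominators in a polynomial over `k(a)`. -/
lemma exists_C_mul_eq_toField (F : MvPolynomial (Fin m) (CoeffField k d)) :
    ∃ (δ : CoeffField k d) (F' : MvPolynomial (Fin m) (CoeffRing k d)), δ ≠ 0 ∧
      MvPolynomial.C δ * F = toField k d F' := by
  obtain ⟨⟨F', ⟨_, ⟨δ, hδ, rfl⟩⟩⟩, h⟩ := IsLocalization.surj
    ((nonZeroDivisors (CoeffRing k d)).map (MvPolynomial.C (σ := Fin m))) F
  refine ⟨algebraMap _ _ δ, F', ?_, ?_⟩
  · rw [Ne, FaithfulSMul.algebraMap_eq_zero_iff]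
    exact nonZeroDivisors.ne_zero hδ
  · rw [mul_comm, ← MvPolynomial.map_C]
    exact h

lemma _root_.Ideal.C_mul_mem_iff {K τ : Type*} [Field K] (I : Ideal (MvPolynomial τ K)) {δ : K}
    (hδ : δ ≠ 0) {F : MvPolynomial τ K} : MvPolynomial.C δ * F ∈ I ↔ F ∈ I := by
  refine ⟨fun h => ?_, fun h => I.mul_mem_left _ h⟩
  have := I.mul_mem_left (MvPolynomial.C δ⁻¹) h
  rwa [← mul_assoc, ← map_mul, inv_mul_cancel₀ hδ, map_one, one_mul] at this

lemma residue_eq_zero_of_toField_mem {F : MvPolynomial (Fin m) (CoeffRing k d)}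
    (h : toField k d F ∈ genericIdeal k d) : residue k d F = 0 := by
  obtain ⟨δ, hδ, h⟩ := (toField_mem_genericIdeal_iff k d).mp h
  have h1 := residue_eq_zero_of_mem k d h
  rw [residue_C_mul] at h1
  refine (mul_eq_zero.mp h1).resolve_left fun h0 => hδ ?_
  exact taylor_injective k d (h0.trans (map_zero _).symm)

/-- The case of a power `q < p`: if `(x₁ + ⋯ + x_m) ^ q * H ^ p` lies in the ideal and its degree
does not exceed the socle degree, then `H` lies in the ideal. -/
lemma mem_genericIdeal_of_pow_char (p : ℕ) [Fact p.Prime] [CharP k p] {s : ℕ}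
    (hs : s + m = ∑ i, d i) (j : Fin m) {H : MvPolynomial (Fin m) (CoeffField k d)} {h q : ℕ}
    (hH : H.IsHomogeneous h) (hq : q < p) (hqs : p * h + q ≤ s)
    (hmem : (∑ i, MvPolynomial.X i) ^ q * H ^ p ∈ genericIdeal k d) :
    H ∈ genericIdeal k d := by
  obtain ⟨δ, H', hδ, hHH'⟩ := exists_C_mul_eq_toField k d H
  rw [← Ideal.C_mul_mem_iff _ hδ, hHH', toField_mem_genericIdeal_iff]
  have hH' : H'.IsHomogeneous h := by
    refine MvPolynomial.IsHomogeneous.of_map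
      (IsFractionRing.injective (CoeffRing k d) (CoeffField k d)) ?_
    rw [← toField, ← hHH']
    simpa using (MvPolynomial.isHomogeneous_C _ δ).mul hH
  refine exists_C_mul_mem_of_residue k d hs hH' fun w hw =>
    residue_monomial_mul_eq_zero k d p hq hs hqs j (fun t => ?_) w hw
  apply residue_eq_zero_of_toField_mem
  rw [map_mul (toField k d)]
  refine Ideal.mul_mem_left _ _ ?_
  rw [map_mul, map_pow, map_pow, map_sum, Finset.sum_congr rfl fun i _ => MvPolynomial.map_X _ i,
    ← hHH', mul_pow, mul_left_comm]
  exact Ideal.mul_mem_left _ _ hmem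

/-- Multiplication by `(x₁ + ⋯ + x_m) ^ n` is injective in degree `i` when `p * i + n` does not
exceed the socle degree: dividing `n` by `p` with remainder lowers the exponent. -/
lemma mem_genericIdeal_of_sum_pow_mul (p : ℕ) [Fact p.Prime] [CharP k p] {s : ℕ}
    (hs : s + m = ∑ i, d i) {G : MvPolynomial (Fin m) (CoeffField k d)} {i : ℕ}
    (hG : G.IsHomogeneous i) (n : ℕ) (hn : p * i + n ≤ s)
    (hmem : (∑ i, MvPolynomial.X i) ^ n * G ∈ genericIdeal k d) : G ∈ genericIdeal k d := by
  induction n using Nat.strong_induction_on with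
  | h n ih =>
    rcases Nat.eq_zero_or_pos n with rfl | hn0
    · simpa using hmem
    have hm : 0 < m := by
      rcases Nat.eq_zero_or_pos m with rfl | h
      · simp at hs
        lia
      · exact h
    have hp : p.Prime := Fact.out
    have hdiv := Nat.div_add_mod n p
    have hlt : n / p < n := Nat.div_lt_self hn0 hp.one_lt
    have hle : n / p ≤ n := hlt.le
    refine ih (n / p) hlt (by lia) (mem_genericIdeal_of_pow_char k d p hs ⟨0, hm⟩
      (h := n / p + i) (q := n % p) ?_ (Nat.mod_lt n hp.pos) (by rw [mul_add]; lia) ?_)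
    · have hX : (∑ i, MvPolynomial.X i :
          MvPolynomial (Fin m) (CoeffField k d)).IsHomogeneous 1 :=
        MvPolynomial.IsHomogeneous.sum _ _ _ fun t _ => MvPolynomial.isHomogeneous_X _ t
      simpa using (hX.pow (n / p)).mul hG
    · have h1 : (∑ i, MvPolynomial.X i) ^ (n % p) * ((∑ i, MvPolynomial.X i) ^ (n / p) * G) ^ p =
          G ^ (p - 1) * ((∑ i, MvPolynomial.X i) ^ n * G) := by
        conv_rhs => rw [← hdiv, pow_add, pow_mul']
        obtain ⟨p', rfl⟩ := Nat.exists_eq_add_of_le hp.one_le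
        rw [Nat.add_sub_cancel_left]
        ring
      rw [h1]
      exact Ideal.mul_mem_left _ _ hmem

end FractionField

/-! ### The graded pieces of the complete intersection -/

section GradedPieces

variable (k : Type*) [Field k] {m : ℕ} (d : Fin m → ℕ)

/-- The class of the monomial `x ^ u`. -/
abbrev monomialClass (u : Fin m →₀ ℕ) :
    MvPolynomial (Fin m) (CoeffField k d) ⧸ genericIdeal k d :=
  Ideal.Quotient.mkₐ (CoeffField k d) (genericIdeal k d) (MvPolynomial.monomial u 1)

lemma quotientPiece_eq_span (n : ℕ) :
    quotientPiece (genericIdeal k d) n =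
      Submodule.span (CoeffField k d) (Set.range fun u : box d n => monomialClass k d u.1) := by
  apply le_antisymm
  · rintro _ ⟨F, hF, rfl⟩
    obtain ⟨ε, F', hε, hFF'⟩ := exists_C_mul_eq_toField k d F
    have hF' : F'.IsHomogeneous n := by
      refine MvPolynomial.IsHomogeneous.of_map
        (IsFractionRing.injective (CoeffRing k d) (CoeffField k d)) ?_
      rw [← toField, ← hFF']
      simpa using (MvPolynomial.isHomogeneous_C _ ε).mul hF
    obtain ⟨δ, hδ, hspan⟩ := exists_smul_mem k d n
    obtain ⟨c, hc⟩ := hspan F' hF'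
    have hδ' : algebraMap (CoeffRing k d) (CoeffField k d) δ ≠ 0 := by
      rwa [Ne, FaithfulSMul.algebraMap_eq_zero_iff]
    have h1 := (toField_mem_genericIdeal_iff k d).mpr ⟨1, one_ne_zero, by rwa [map_one, one_mul]⟩
    rw [map_sub, map_mul, ← hFF', MvPolynomial.map_C, map_sum, ← mul_assoc, ← map_mul,
      ← MvPolynomial.smul_eq_C_mul, ← Ideal.Quotient.mk_eq_mk_iff_sub_mem] at h1
    have h2 : Ideal.Quotient.mkₐ (CoeffField k d) (genericIdeal k d)
        ((algebraMap (CoeffRing k d) (CoeffField k d) δ * ε) • F) =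
        ∑ u ∈ box d n, algebraMap (CoeffRing k d) (CoeffField k d) (c u) • monomialClass k d u := by
      refine h1.trans ?_
      rw [map_sum]
      refine Finset.sum_congr rfl fun u _ => ?_
      rw [← map_smul, MvPolynomial.smul_monomial, smul_eq_mul, mul_one, MvPolynomial.map_monomial]
      rfl
    rw [map_smul] at h2
    refine (Submodule.smul_mem_iff _ (mul_ne_zero hδ' hε)).mp ?_
    change (algebraMap (CoeffRing k d) (CoeffField k d) δ * ε) •
      Ideal.Quotient.mkₐ (CoeffField k d) (genericIdeal k d) F ∈ _
    rw [h2]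
    exact Submodule.sum_mem _ fun u hu =>
      Submodule.smul_mem _ _ (Submodule.subset_span ⟨⟨u, hu⟩, rfl⟩)
  · rw [Submodule.span_le]
    rintro _ ⟨u, rfl⟩
    exact ⟨MvPolynomial.monomial u.1 1,
      MvPolynomial.isHomogeneous_monomial _ (mem_box.mp u.2).1, rfl⟩

lemma linearIndependent_monomialClass {s : ℕ} (hs : s + m = ∑ i, d i) (n : ℕ) :
    LinearIndependent (CoeffField k d) (fun u : box d n => monomialClass k d u.1) := by
  classical
  rw [Fintype.linearIndependent_iff]
  intro a ha
  obtain ⟨b, hb⟩ := IsLocalization.exist_integer_multiples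
    (nonZeroDivisors (CoeffRing k d)) (Finset.univ : Finset (box d n)) a
  choose c hc using fun u => hb u (Finset.mem_univ u)
  have hb0 : (b : CoeffRing k d) ≠ 0 := nonZeroDivisors.ne_zero b.2
  let c' : (Fin m →₀ ℕ) → CoeffRing k d := fun u => if hu : u ∈ box d n then c ⟨u, hu⟩ else 0
  have hc' : ∀ u : box d n, c' u.1 = c u := fun u => dif_pos u.2
  have hmem : toField k d (∑ u ∈ box d n, MvPolynomial.monomial u (c' u)) ∈ genericIdeal k d := by
    rw [← Ideal.Quotient.eq_zero_iff_mem, map_sum, ← Finset.sum_coe_sort]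
    have h1 : ∀ u : box d n, toField k d (MvPolynomial.monomial u.1 (c' u.1)) =
        (algebraMap (CoeffRing k d) (CoeffField k d) b) •
          a u • MvPolynomial.monomial u.1 (1 : CoeffField k d) := by
      intro u
      rw [MvPolynomial.map_monomial, hc', hc, smul_smul, MvPolynomial.smul_monomial, smul_eq_mul,
        mul_one, Algebra.smul_def]
    rw [Finset.sum_congr rfl fun u _ => h1 u, ← Finset.smul_sum]
    change Ideal.Quotient.mkₐ (CoeffField k d) (genericIdeal k d) _ = 0
    rw [map_smul, map_sum]
    simp_rw [map_smul]
    rw [ha, smul_zero]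
  have h0 := eq_zero_of_residue_sum_box k d hs c' (n := n) fun w _ => by
    apply residue_eq_zero_of_toField_mem
    rw [map_mul]
    exact Ideal.mul_mem_left _ _ hmem
  intro u
  have h2 := hc u
  rw [← hc', h0 u.1 u.2, map_zero, Algebra.smul_def] at h2
  refine (mul_eq_zero.mp h2.symm).resolve_left ?_
  rwa [FaithfulSMul.algebraMap_eq_zero_iff]

end GradedPieces

/-! ### Lefschetz properties -/

section StrongLefschetz

variable (k : Type*) [Field k] {m : ℕ} (d : Fin m → ℕ)

instance finiteDimensional_quotientPiece (n : ℕ) :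
    FiniteDimensional (CoeffField k d) (quotientPiece (genericIdeal k d) n) := by
  rw [quotientPiece_eq_span]
  exact FiniteDimensional.span_of_finite _ (Set.finite_range _)

lemma finrank_quotientPiece {s : ℕ} (hs : s + m = ∑ i, d i) (n : ℕ) :
    Module.finrank (CoeffField k d) (quotientPiece (genericIdeal k d) n) = (box d n).card := by
  rw [quotientPiece_eq_span, finrank_span_eq_card (linearIndependent_monomialClass k d hs n),
    Fintype.card_coe]

lemma quotientPiece_eq_bot {s n : ℕ} (hs : s + m = ∑ i, d i) (hn : s < n) :
    quotientPiece (genericIdeal k d) n = ⊥ := by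
  apply Submodule.finrank_eq_zero.mp
  rw [finrank_quotientPiece k d hs, box_eq_empty d hs hn, Finset.card_empty]

lemma topDegree_add (hd : ∀ i, 0 < d i) : topDegree d + m = ∑ i, d i := by
  have : ∑ _i : Fin m, 1 ≤ ∑ i, d i := Finset.sum_le_sum fun i _ => hd i
  rw [Finset.sum_const, Finset.card_univ, Fintype.card_fin, smul_eq_mul, mul_one] at this
  rw [topDegree]
  lia

@[simp] lemma coe_mulPow {K A : Type*} [Field K] [CommRing A] [Algebra K A]
    (𝒜 : ℕ → Submodule K A) [SetLike.GradedMonoid 𝒜] (L : 𝒜 1) (i n : ℕ) (a : 𝒜 i) :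
    (mulPow 𝒜 L i n a : A) = (L : A) ^ n * a := rfl

lemma mulPow_sumVars_injective (p : ℕ) [Fact p.Prime] [CharP k p] (hd : ∀ i, 0 < d i) {i n : ℕ}
    (h : p * i + n ≤ topDegree d) :
    Function.Injective
      (mulPow (quotientPiece (genericIdeal k d)) (sumVars (genericIdeal k d)) i n) := by
  rw [injective_iff_map_eq_zero]
  rintro ⟨_, G, hG, rfl⟩ h0
  apply Subtype.ext
  refine Ideal.Quotient.eq_zero_iff_mem.mpr ?_
  refine mem_genericIdeal_of_sum_pow_mul k d p (topDegree_add d hd) hG n h ?_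
  have h1 := congrArg Subtype.val h0
  rw [coe_mulPow] at h1
  refine Ideal.Quotient.eq_zero_iff_mem.mp (Eq.trans ?_ h1)
  rw [map_mul, map_pow]
  rfl

lemma mulPow_bijective_of_injective {s i n : ℕ} (hs : s + m = ∑ i, d i) (hi : 2 * i + n = s)
    (L : quotientPiece (genericIdeal k d) 1)
    (h : Function.Injective (mulPow (quotientPiece (genericIdeal k d)) L i n)) :
    Function.Bijective (mulPow (quotientPiece (genericIdeal k d)) L i n) := by
  refine ⟨h, (LinearMap.injective_iff_surjective_of_finrank_eq_finrank ?_).mp h⟩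
  rw [finrank_quotientPiece k d hs, finrank_quotientPiece k d hs]
  exact card_box_eq d hs (by lia)

/-- The bijections from degree `i` to degree `s - i` factor through all the maps in between, which
yields the Strong Lefschetz Property. -/
lemma mulPow_injective_or_surjective {s : ℕ} (hs : s + m = ∑ i, d i)
    (L : quotientPiece (genericIdeal k d) 1)
    (hL : ∀ i n, 2 * i + n = s →
      Function.Bijective (mulPow (quotientPiece (genericIdeal k d)) L i n)) (i n : ℕ) :
    Function.Injective (mulPow (quotientPiece (genericIdeal k d)) L i n) ∨
      Function.Surjective (mulPow (quotientPiece (genericIdeal k d)) L i n) := by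
  rcases le_or_gt (2 * i + n) s with h | h
  · left
    obtain ⟨e, he⟩ := exists_add_of_le h
    have hinj := (hL i (n + e) (by lia)).1
    rw [injective_iff_map_eq_zero] at hinj ⊢
    intro a ha
    apply hinj a
    apply Subtype.ext
    have h1 := congrArg Subtype.val ha
    rw [coe_mulPow] at h1 ⊢
    rw [pow_add, mul_comm ((L : _ ⧸ genericIdeal k d) ^ n), mul_assoc, h1]
    exact mul_zero _
  · right
    rintro ⟨b, hb⟩
    rcases lt_or_ge s (i + n) with h' | h'
    · refine ⟨0, Subtype.ext ?_⟩
      rw [quotientPiece_eq_bot k d hs h', Submodule.mem_bot] at hb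
      rw [map_zero]
      exact hb.symm
    · -- `b` has degree `i + n = s - i'` with `i' ≤ i`.
      obtain ⟨i', hi'⟩ := exists_add_of_le h'
      obtain ⟨e, rfl⟩ : ∃ e, i = i' + e := exists_add_of_le (by lia)
      have hdeg : i' + (e + n) = i' + e + n := (add_assoc _ _ _).symm
      obtain ⟨a, ha⟩ := (hL i' (e + n) (by lia)).2 ⟨b, hdeg ▸ hb⟩
      refine ⟨mulPow (quotientPiece (genericIdeal k d)) L i' e a, Subtype.ext ?_⟩
      have h1 := congrArg Subtype.val ha
      rw [coe_mulPow] at h1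
      rw [coe_mulPow, coe_mulPow, ← mul_assoc, ← pow_add, add_comm n e]
      exact h1

end StrongLefschetz
end GenericCI
end

theorem corollary4p6 {k : Type*} [Field k] (p : ℕ) [Fact p.Prime] [CharP k p]
    {m : ℕ} (d : Fin m → ℕ) (hd : ∀ i, 0 < d i) :
    (∀ i : ℕ, p * i ≤ GenericCI.topDegree d →
      Function.Injective
        (GenericCI.mulPow (GenericCI.quotientPiece (GenericCI.genericIdeal k d))
          (GenericCI.sumVars (GenericCI.genericIdeal k d)) i (GenericCI.topDegree d - p * i))) ∧
    (p = 2 →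
      GenericCI.HasStrongLefschetzProperty
          (GenericCI.quotientPiece (GenericCI.genericIdeal k d)) ∧
      ∀ i : ℕ, 2 * i ≤ GenericCI.topDegree d →
        Function.Bijective
          (GenericCI.mulPow (GenericCI.quotientPiece (GenericCI.genericIdeal k d))
            (GenericCI.sumVars (GenericCI.genericIdeal k d)) i
            (GenericCI.topDegree d - 2 * i))) := by
  have hs := GenericCI.topDegree_add d hd
  refine ⟨fun i hi => GenericCI.mulPow_sumVars_injective k d p hd (by lia), fun hp => ?_⟩
  subst hp
  have hbij : ∀ i n, 2 * i + n = GenericCI.topDegree d → Function.Bijective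
      (GenericCI.mulPow (GenericCI.quotientPiece (GenericCI.genericIdeal k d))
        (GenericCI.sumVars (GenericCI.genericIdeal k d)) i n) := fun i n h =>
    GenericCI.mulPow_bijective_of_injective k d hs h _
      (GenericCI.mulPow_sumVars_injective k d 2 hd h.le)
  exact ⟨⟨_, GenericCI.mulPow_injective_or_surjective k d hs _ hbij⟩,
    fun i hi => hbij i _ (by lia)⟩
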